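/- Let $L\subset\mathbb{RP}^3$ be a projective line. Call planes through $L$ horizontal, and call a projective line non-horizontal if it does not meet $L$. Let $B\subset\mathbb{RP}^3$ be a (projective) convex-concave body with respect to $L$, that is, a non-empty closed set with $B\cap L=\emptyset$ such that (i) for every horizontal plane $N$ the section $B\cap N$ is convex (in the affine plane $N\setminus L$), and (ii) for any three distinct horizontal planes $N_1,N_2,N_3$, through every point of $B\cap N_1$ passes a projective line that meets both $B\cap N_2$ and $B\cap N_3$. Let $L_1,\dots,L_5$ be five distinct horizontal planes and $S_i=B\cap L_i$. Choose homogeneous coordinates $(\tilde x:\tilde y:\tilde z:\tilde w)$ such that $L=\{\tilde z=\tilde w=0\}$ and all $S_i$ lie in the affine chart $\{\tilde w\neq 0\}\cong\mathbb R^3$ with coordinates $(\tilde x/\tilde w,\tilde y/\tilde w,\tilde z/\tilde w)$, and measure distances by the standard Euclidean metric of this chart. Let $\ell$ be a Chebyshev line, that is, a non-horizontal line that minimizes $$\max_{i=1,\dots,5}\operatorname{dist}(\ell\cap L_i,S_i)$$ among all non-horizontal lines. Then $\ell$ meets each $L_i$ in exactly one point $a_i$ of the chart, there is a point $s_i\in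 S_i$ closest to $a_i$, and the five numbers $\operatorname{dist}(a_i,S_i)=\operatorname{dist}(a_i,s_i)$, $i=1,\dots,5$, are all equal. Consequently, if no projective line meets all five sections $S_1,\dots,S_5$, then $\ell$ meets none of them. -/

import Mathlib

open scoped LinearAlgebra.Projectivization

noncomputable section

namespace ChebyshevLine

/-- Homogeneous coordinate space of real projective 3-space. -/
abbrev V : Type := Fin 4 → ℝ

/-- Real projective 3-space. -/
abbrev RP3 : Type := ℙ ℝ V

/-- The affine space `ℝ³` with its standard scalar product. -/
abbrev E3 : Type := EuclideanSpace ℝ (Fin 3)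

/-- The projective subspace cut out by a linear subspace `M`, as a set of points. -/
def points (M : Submodule ℝ V) : Set RP3 := {p | p.submodule ≤ M}

/-- `M` represents a projective line. -/
def IsLine (M : Submodule ℝ V) : Prop := Module.finrank ℝ M = 2

/-- `N` represents a horizontal plane: a projective plane through the line `L`. -/
def IsHorizontalPlane (L N : Submodule ℝ V) : Prop := Module.finrank ℝ N = 3 ∧ L ≤ N

/-- `M` represents a non-horizontal line: a projective line that does not meet `L`. -/
def IsNonHorizontalLine (L M : Submodule ℝ V) : Prop :=
  IsLine M ∧ points M ∩ points L = ∅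

/-- The section of `B` by the plane `N`. -/
def planeSection (B : Set RP3) (N : Submodule ℝ V) : Set RP3 := B ∩ points N

/-- Closedness for the quotient topology of `RP3 = (V \ {0}) / ℝˣ`. -/
def IsClosedProj (B : Set RP3) : Prop :=
  IsClosed {v : {v : V // v ≠ 0} | Projectivization.mk ℝ v.1 v.2 ∈ B}

/-- Convexity of a set `S` of points of the plane `N` in the affine plane `N \ L`. A linear
functional `f` whose zero set in `N` is `L` identifies `N \ L` with the affine plane
`{v ∈ N | f v = 1}`; on `N` such an `f` is unique up to a nonzero factor. -/
def IsConvexOff (L N : Submodule ℝ V) (S : Set RP3) : Prop :=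
  ∀ f : V →ₗ[ℝ] ℝ, N ⊓ LinearMap.ker f = L →
    Convex ℝ {v : V | v ∈ N ∧ f v = 1 ∧ ∃ hv : v ≠ 0, Projectivization.mk ℝ v hv ∈ S}

/-- Projective convex-concave bodies with respect to the infinite line `L`. -/
structure IsConvexConcave (L : Submodule ℝ V) (B : Set RP3) : Prop where
  isLine : IsLine L
  nonempty : B.Nonempty
  closed : IsClosedProj B
  disjoint : B ∩ points L = ∅
  convex : ∀ N, IsHorizontalPlane L N → IsConvexOff L N (planeSection B N)
  concave : ∀ N₁ N₂ N₃, IsHorizontalPlane L N₁ → IsHorizontalPlane L N₂ →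
    IsHorizontalPlane L N₃ → N₁ ≠ N₂ → N₁ ≠ N₃ → N₂ ≠ N₃ →
    ∀ p ∈ planeSection B N₁, ∃ M, IsLine M ∧ p ∈ points M ∧
      (points M ∩ planeSection B N₂).Nonempty ∧ (points M ∩ planeSection B N₃).Nonempty

/-- The point `[x : y : z : 1]` in the homogeneous coordinates `e`. -/
def ofAffine (e : V ≃ₗ[ℝ] V) (q : E3) : RP3 :=
  Projectivization.mk ℝ (e.symm ![q 0, q 1, q 2, 1]) (by
    intro h
    have h' : (![q 0, q 1, q 2, 1] : V) = 0 := (LinearEquiv.map_eq_zero_iff e.symm).mp h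
    have h3 := congrFun h' 3
    simp at h3)

/-- The part of `A` in the affine chart `w ≠ 0` of the coordinates `e = (x, y, z, w)`,
as a subset of `ℝ³`. -/
def affinePart (e : V ≃ₗ[ℝ] V) (A : Set RP3) : Set E3 := {q | ofAffine e q ∈ A}

/-- The distance between two sets, `inf {|p - q| : p ∈ A, q ∈ C}`. -/
def setDist (A C : Set E3) : ℝ := sInf (Set.image2 dist A C)

/-- The distance, in the plane `N`, from the point where `M` meets `N` to the section of `B`. -/
def distToSection (e : V ≃ₗ[ℝ] V) (B : Set RP3) (M N : Submodule ℝ V) : ℝ :=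
  setDist (affinePart e (points M ∩ points N)) (affinePart e (planeSection B N))

/-- `M` minimizes the maximal distance to the five sections among non-horizontal lines. -/
def IsChebyshevLine (L : Submodule ℝ V) (e : V ≃ₗ[ℝ] V) (B : Set RP3)
    (P : Fin 5 → Submodule ℝ V) (M : Submodule ℝ V) : Prop :=
  IsNonHorizontalLine L M ∧ ∀ M', IsNonHorizontalLine L M' →
    (⨆ i, distToSection e B M (P i)) ≤ ⨆ i, distToSection e B M' (P i)

end ChebyshevLine

end

/-! In the chart, a non-horizontal line is `t ↦ x.1 + t • x.2` with the parameter equal to the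
height. Such `x` form a convex set, and the point at a fixed height depends linearly on `x`.

Any four sections have a common transversal. The lines meeting sections 1, 2, 3 and those meeting 1,
2, 4 form two compact convex sets; concavity provides partners agreeing on section 2 in one
direction and on section 1 in the other. A separation argument (`exists_common_values`) then yields
a pair agreeing on both, hence a single line.

Now suppose one distance of the Chebyshev line is below the maximum `r`. Moving the line slightly
towards a transversal of the other four sections shrinks those four distances by a factor `1 - ε`,
while the fifth stays below `r` by continuity. This contradicts minimality
(`infDist_eq_iSup_of_minimizer`). If the line meets one section, the common distance is `0`, so it
meets all five. -/

namespace ChebyshevLine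

/-! ### Coincidence by separation -/

/-- If two compact convex sets `A`, `C` are such that every point of `A` has a partner in `C` with
the same `f`-value, and every point of `C` has a partner in `A` with the same `g`-value, then some
pair of points agrees under both `f` and `g`. -/
theorem exists_common_values {E F G : Type*}
    [NormedAddCommGroup E] [NormedSpace ℝ E] [NormedAddCommGroup F] [NormedSpace ℝ F]
    [NormedAddCommGroup G] [NormedSpace ℝ G] {A C : Set E}
    (hA : IsCompact A) (hC : IsCompact C) (hAc : Convex ℝ A) (hCc : Convex ℝ C)
    (hne : A.Nonempty) (f : E →L[ℝ] F) (g : E →L[ℝ] G)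
    (hf : ∀ p ∈ A, ∃ p' ∈ C, f p = f p') (hg : ∀ p' ∈ C, ∃ p ∈ A, g p = g p') :
    ∃ p ∈ A, ∃ p' ∈ C, f p = f p' ∧ g p = g p' := by
  let T : Set (E × E) := (A ×ˢ C) ∩ {x | f x.1 = f x.2}
  have hTcomp : IsCompact T :=
    (hA.prod hC).inter_right (isClosed_eq (by fun_prop) (by fun_prop))
  have hTconv : Convex ℝ T := by
    refine (hAc.prod hCc).inter ?_
    intro x hx y hy a b _ _ _
    simp only [Set.mem_ofPred_eq] at hx hy ⊢
    simp [hx, hy]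
  let d : E × E →L[ℝ] G :=
    g.comp (ContinuousLinearMap.snd ℝ E E) - g.comp (ContinuousLinearMap.fst ℝ E E)
  have hd : ∀ x, d x = g x.2 - g x.1 := fun x => rfl
  have hDcomp : IsCompact (d '' T) := hTcomp.image d.continuous
  have hDconv : Convex ℝ (d '' T) := hTconv.linear_image d.toLinearMap
  by_cases h0 : (0 : G) ∈ d '' T
  · obtain ⟨x, ⟨⟨h1, h2⟩, h3⟩, h4⟩ := h0
    refine ⟨x.1, h1, x.2, h2, h3, ?_⟩
    rw [hd] at h4
    exact (sub_eq_zero.mp h4).symm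
  -- Otherwise some `ψ` is positive on all differences, so passing to a partner strictly increases
  -- `ψ ∘ g`. Start at its maximum over `A`: the partner in `C`, and then a point of `A` with the
  -- same `g`-value, exceed that maximum.
  · obtain ⟨ψ, u, hu, hψ⟩ := geometric_hahn_banach_point_closed hDconv hDcomp.isClosed h0
    rw [map_zero] at hu
    obtain ⟨p, hp, hmax⟩ := hA.exists_isMaxOn hne (f := fun p => ψ (g p)) (by fun_prop)
    obtain ⟨p', hp', hpp'⟩ := hf p hp
    obtain ⟨q, hq, hqp'⟩ := hg p' hp'
    have h1 := hψ (d (p, p')) ⟨(p, p'), ⟨⟨hp, hp'⟩, hpp'⟩, rfl⟩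
    have h2 : ψ (g q) ≤ ψ (g p) := hmax hq
    rw [hd, map_sub] at h1
    rw [hqp'] at h2
    simp only at h1
    linarith

/-! ### Parametrized lines and common transversals -/

/-- The point with parameter `t` on the parametrized line `s ↦ x.1 + s • x.2`. -/
def ev {E : Type*} [NormedAddCommGroup E] [NormedSpace ℝ E] (t : ℝ) : E × E →L[ℝ] E :=
  ContinuousLinearMap.fst ℝ E E + t • ContinuousLinearMap.snd ℝ E E

section Affine

variable {E : Type*} [NormedAddCommGroup E] [NormedSpace ℝ E]

theorem ev_apply (t : ℝ) (x : E × E) : ev t x = x.1 + t • x.2 := rfl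

/-- The parametrized line through `z.1` at parameter `s` and `z.2` at parameter `t`. -/
noncomputable def lineThrough (s t : ℝ) (z : E × E) : E × E :=
  (z.1 - s • (t - s)⁻¹ • (z.2 - z.1), (t - s)⁻¹ • (z.2 - z.1))

theorem continuous_lineThrough (s t : ℝ) : Continuous (lineThrough (E := E) s t) := by
  unfold lineThrough
  fun_prop

theorem lineThrough_ev {s t : ℝ} (h : s ≠ t) (x : E × E) :
    lineThrough s t (ev s x, ev t x) = x := by
  have h' : t - s ≠ 0 := sub_ne_zero.mpr h.symm
  have h2 : (t - s)⁻¹ • (ev t x - ev s x) = x.2 := by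
    rw [ev_apply, ev_apply, add_sub_add_left_eq_sub, ← sub_smul, smul_smul,
      inv_mul_cancel₀ h', one_smul]
  unfold lineThrough
  ext1
  · change ev s x - s • (t - s)⁻¹ • (ev t x - ev s x) = x.1
    rw [h2, ev_apply, add_sub_cancel_right]
  · exact h2

theorem ev_lineThrough_left (s t : ℝ) (z : E × E) :
    ev s (lineThrough s t z) = z.1 := by
  simp [ev_apply, lineThrough]

theorem ev_lineThrough_right {s t : ℝ} (h : s ≠ t) (z : E × E) :
    ev t (lineThrough s t z) = z.2 := by
  have h' : t - s ≠ 0 := sub_ne_zero.mpr h.symm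
  have : ev t (lineThrough s t z) = z.1 + ((t - s) * (t - s)⁻¹) • (z.2 - z.1) := by
    simp only [ev_apply, lineThrough]
    module
  rw [this, mul_inv_cancel₀ h', one_smul, add_sub_cancel]

/-- Two points at distinct parameters determine the line continuously, so the first two conditions
already confine it to a compact set; the third is merely closed. -/
theorem isCompact_lines_meeting {s t u : ℝ} (h : s ≠ t) {K₁ K₂ K₃ : Set E}
    (h₁ : IsCompact K₁) (h₂ : IsCompact K₂) (h₃ : IsCompact K₃) :
    IsCompact {x : E × E | ev s x ∈ K₁ ∧ ev t x ∈ K₂ ∧ ev u x ∈ K₃} := by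
  refine ((h₁.prod h₂).image (continuous_lineThrough s t)).of_isClosed_subset ?_ ?_
  · exact (h₁.isClosed.preimage (ev s).continuous).inter
      ((h₂.isClosed.preimage (ev t).continuous).inter (h₃.isClosed.preimage (ev u).continuous))
  · rintro x ⟨hx₁, hx₂, -⟩
    exact ⟨(ev s x, ev t x), ⟨hx₁, hx₂⟩, lineThrough_ev h x⟩

theorem convex_lines_meeting {s t u : ℝ} {K₁ K₂ K₃ : Set E}
    (h₁ : Convex ℝ K₁) (h₂ : Convex ℝ K₂) (h₃ : Convex ℝ K₃) :
    Convex ℝ {x : E × E | ev s x ∈ K₁ ∧ ev t x ∈ K₂ ∧ ev u x ∈ K₃} :=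
  (h₁.linear_preimage (ev s).toLinearMap).inter
    ((h₂.linear_preimage (ev t).toLinearMap).inter (h₃.linear_preimage (ev u).toLinearMap))

/-- Four compact convex sets in parallel planes have a common transversal line as soon as every
point of the first lies on a line meeting the second and the third, and every point of the second
lies on a line meeting the first and the fourth. -/
theorem exists_line_meeting_four {t₁ t₂ t₃ t₄ : ℝ} (h : t₁ ≠ t₂) {K₁ K₂ K₃ K₄ : Set E}
    (c₁ : IsCompact K₁) (c₂ : IsCompact K₂) (c₃ : IsCompact K₃) (c₄ : IsCompact K₄)
    (v₁ : Convex ℝ K₁) (v₂ : Convex ℝ K₂) (v₃ : Convex ℝ K₃) (v₄ : Convex ℝ K₄)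
    (hne : K₁.Nonempty)
    (h₁ : ∀ q ∈ K₁, ∃ x : E × E, ev t₁ x = q ∧ ev t₂ x ∈ K₂ ∧ ev t₃ x ∈ K₃)
    (h₂ : ∀ q ∈ K₂, ∃ x : E × E, ev t₂ x = q ∧ ev t₁ x ∈ K₁ ∧ ev t₄ x ∈ K₄) :
    ∃ x : E × E, ev t₁ x ∈ K₁ ∧ ev t₂ x ∈ K₂ ∧ ev t₃ x ∈ K₃ ∧ ev t₄ x ∈ K₄ := by
  obtain ⟨p, ⟨hp₁, hp₂, hp₃⟩, p', ⟨-, -, hp₄⟩, hf, hg⟩ := exists_common_values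
    (isCompact_lines_meeting h c₁ c₂ c₃) (isCompact_lines_meeting h c₁ c₂ c₄)
    (convex_lines_meeting v₁ v₂ v₃) (convex_lines_meeting v₁ v₂ v₄)
    (by
      obtain ⟨q, hq⟩ := hne
      obtain ⟨x, hx, hx'⟩ := h₁ q hq
      exact ⟨x, by rwa [hx], hx'⟩)
    (ev t₂) (ev t₁)
    (by
      rintro p ⟨-, hp, -⟩
      obtain ⟨x, hx, hx₁, hx₄⟩ := h₂ _ hp
      exact ⟨x, ⟨hx₁, by rwa [hx], hx₄⟩, hx.symm⟩)
    (by
      rintro p ⟨hp, -, -⟩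
      obtain ⟨x, hx, hx'⟩ := h₁ _ hp
      exact ⟨x, ⟨by rwa [hx], hx'⟩, hx⟩)
  -- The two lines share their points at `t₁` and `t₂`, so they coincide.
  have : p = p' := by rw [← lineThrough_ev h p, ← lineThrough_ev h p', hf, hg]
  subst this
  exact ⟨p, hp₁, hp₂, hp₃, hp₄⟩

/-! ### Equidistance of a minimizer -/

/-- Moving from `a` towards a point of a convex set decreases the distance to that set
proportionally. -/
theorem infDist_lineMap_le {K : Set E} (hK : IsCompact K) (hv : Convex ℝ K) {a q : E}
    (hq : q ∈ K) {ε : ℝ} (h0 : 0 ≤ ε) (h1 : ε ≤ 1) :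
    Metric.infDist (a + ε • (q - a)) K ≤ (1 - ε) * Metric.infDist a K := by
  obtain ⟨s, hs, hsd⟩ := hK.exists_infDist_eq_dist ⟨q, hq⟩ a
  have hmem : (1 - ε) • s + ε • q ∈ K := hv hs hq (by linarith) h0 (by ring)
  refine (Metric.infDist_le_dist_of_mem hmem).trans_eq ?_
  have : a + ε • (q - a) - ((1 - ε) • s + ε • q) = (1 - ε) • (a - s) := by module
  rw [hsd, dist_eq_norm, this, norm_smul, Real.norm_of_nonneg (by linarith), dist_eq_norm]

/-- If for every index `i` some line of the convex family `Λ` meets all the sets `K j`, `j ≠ i`,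
then a line of `Λ` minimizing the maximal distance to the sets is equidistant from all of them. -/
theorem infDist_eq_iSup_of_minimizer {ι : Type*} [Finite ι] {K : ι → Set E} {t : ι → ℝ}
    (hK : ∀ i, IsCompact (K i)) (hv : ∀ i, Convex ℝ (K i)) {Λ : Set (E × E)}
    (hΛ : Convex ℝ Λ) (hmeet : ∀ i, ∃ x ∈ Λ, ∀ j, j ≠ i → ev (t j) x ∈ K j)
    {m : E × E} (hm : m ∈ Λ)
    (hmin : ∀ x ∈ Λ, (⨆ i, Metric.infDist (ev (t i) m) (K i)) ≤
      ⨆ i, Metric.infDist (ev (t i) x) (K i)) (i : ι) :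
    Metric.infDist (ev (t i) m) (K i) = ⨆ j, Metric.infDist (ev (t j) m) (K j) := by
  have hle : ∀ j, Metric.infDist (ev (t j) m) (K j) ≤
      ⨆ j, Metric.infDist (ev (t j) m) (K j) :=
    fun j => le_ciSup (f := fun j => Metric.infDist (ev (t j) m) (K j))
      (Set.finite_range _).bddAbove j
  refine (hle i).antisymm (not_lt.mp fun hlt => ?_)
  set r := ⨆ j, Metric.infDist (ev (t j) m) (K j) with hr
  have hr0 : 0 < r := Metric.infDist_nonneg.trans_lt hlt
  obtain ⟨x, hx, hxK⟩ := hmeet i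
  have hcont : Continuous fun ε : ℝ => Metric.infDist (ev (t i) (m + ε • (x - m))) (K i) :=
    (Metric.continuous_infDist_pt _).comp ((ev (t i)).continuous.comp (by fun_prop))
  have hev : ∀ᶠ ε in nhdsWithin (0 : ℝ) (Set.Ioi 0),
      Metric.infDist (ev (t i) (m + ε • (x - m))) (K i) < r :=
    (hcont.continuousAt.eventually_lt continuousAt_const (by simpa using hlt)).filter_mono
      nhdsWithin_le_nhds
  obtain ⟨ε, hε, h0, h1⟩ := (hev.and (Ioo_mem_nhdsGT (zero_lt_one (α := ℝ)))).exists
  have hmem : m + ε • (x - m) ∈ Λ := hΛ.add_smul_sub_mem hm hx ⟨h0.le, h1.le⟩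
  have : Nonempty ι := ⟨i⟩
  obtain ⟨j, hj⟩ := exists_eq_ciSup_of_finite
    (f := fun j => Metric.infDist (ev (t j) (m + ε • (x - m))) (K j))
  have hrj := hmin _ hmem
  rw [← hj] at hrj
  -- The maximum at the perturbed line is attained at some `j`: for `j = i` it is below `r` by the
  -- choice of `ε`, otherwise it is at most `(1 - ε) * r < r`.
  by_cases hji : j = i
  · subst hji
    exact absurd hε (not_lt.mpr hrj)
  · have hb := infDist_lineMap_le (hK j) (hv j) (a := ev (t j) m) (hxK j hji) h0.le h1.le
    rw [← map_sub, ← map_smul, ← map_add] at hb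
    nlinarith [hle j, mul_pos h0 hr0]

/-- Among five compact convex sets in parallel planes, any four have a common transversal if
through every point of any of them passes a line meeting any given two others. -/
theorem exists_line_meeting_all_but_one {K : Fin 5 → Set E} {t : Fin 5 → ℝ}
    (ht : Function.Injective t) (hK : ∀ i, IsCompact (K i)) (hv : ∀ i, Convex ℝ (K i))
    (hne : ∀ i, (K i).Nonempty)
    (hconc : ∀ i j k, i ≠ j → i ≠ k → j ≠ k → ∀ q ∈ K i,
      ∃ x : E × E, ev (t i) x = q ∧ ev (t j) x ∈ K j ∧ ev (t k) x ∈ K k) (i : Fin 5) :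
    ∃ x : E × E, ∀ j, j ≠ i → ev (t j) x ∈ K j := by
  have key : ∀ i : Fin 5, ∃ a b c d : Fin 5, a ≠ b ∧ a ≠ c ∧ a ≠ d ∧ b ≠ c ∧ b ≠ d ∧
      ∀ j, j ≠ i → j = a ∨ j = b ∨ j = c ∨ j = d := by
    intro i
    -- Addition in `Fin 5` is cyclic, so these are the four other indices.
    refine ⟨i + 1, i + 2, i + 3, i + 4, ?_⟩
    revert i
    decide
  obtain ⟨a, b, c, d, hab, hac, had, hbc, hbd, hall⟩ := key i
  obtain ⟨x, ha, hb, hc, hd⟩ := exists_line_meeting_four (ht.ne hab) (hK a) (hK b) (hK c) (hK d)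
    (hv a) (hv b) (hv c) (hv d) (hne a) (hconc a b c hab hac hbc) (hconc b a d hab.symm hbd had)
  refine ⟨x, fun j hj => ?_⟩
  rcases hall j hj with rfl | rfl | rfl | rfl <;> assumption

end Affine

/-! ### Homogeneous coordinates and horizontal planes -/

section Projective

variable (e : V ≃ₗ[ℝ] V)

/-- The vector with homogeneous coordinates `(q, w)` with respect to `e`. -/
noncomputable def homog (q : E3) (w : ℝ) : V := e.symm ![q 0, q 1, q 2, w]

theorem e_homog (q : E3) (w : ℝ) : e (homog e q w) = ![q 0, q 1, q 2, w] :=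
  e.apply_symm_apply _

theorem homog_add_smul (q d : E3) (t v w : ℝ) :
    homog e (q + t • d) (v + t * w) = homog e q v + t • homog e d w := by
  apply e.injective
  rw [map_add, map_smul, e_homog, e_homog, e_homog]
  ext i
  fin_cases i <;> simp

theorem homog_ne_zero (q : E3) {w : ℝ} (hw : w ≠ 0) : homog e q w ≠ 0 := by
  intro h
  have h3 := congrFun (e_homog e q w) 3
  rw [h, map_zero] at h3
  exact hw (by simpa using h3.symm)

theorem ofAffine_eq (q : E3) :
    ofAffine e q = Projectivization.mk ℝ (homog e q 1) (homog_ne_zero e q one_ne_zero) := rfl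

theorem mk_mem_points {v : V} (hv : v ≠ 0) (N : Submodule ℝ V) :
    Projectivization.mk ℝ v hv ∈ points N ↔ v ∈ N := by
  change (Projectivization.mk ℝ v hv).submodule ≤ N ↔ v ∈ N
  rw [Projectivization.submodule_mk, Submodule.span_singleton_le_iff_mem]

theorem ofAffine_mem_points (q : E3) (N : Submodule ℝ V) :
    ofAffine e q ∈ points N ↔ homog e q 1 ∈ N :=
  mk_mem_points _ _

/-- The affine coordinates of a vector. -/
noncomputable def chart (v : V) : E3 := !₂[e v 0 / e v 3, e v 1 / e v 3, e v 2 / e v 3]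

theorem eq_smul_homog_chart {v : V} (h : e v 3 ≠ 0) : v = e v 3 • homog e (chart e v) 1 := by
  apply e.injective
  rw [map_smul, e_homog]
  ext i
  fin_cases i <;> simp [chart, mul_div_cancel₀, h]

theorem mk_eq_ofAffine_chart {v : V} (hv : v ≠ 0) (h : e v 3 ≠ 0) :
    Projectivization.mk ℝ v hv = ofAffine e (chart e v) := by
  rw [ofAffine_eq, Projectivization.mk_eq_mk_iff']
  exact ⟨e v 3, (eq_smul_homog_chart e h).symm⟩

theorem chart_smul_homog (q : E3) {c : ℝ} (hc : c ≠ 0) : chart e (c • homog e q 1) = q := by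
  ext i
  simp only [chart, map_smul, e_homog]
  fin_cases i <;> simp [hc]

/-- The linear form `d z - c w`, whose kernel is the horizontal plane `z / w = c / d`. -/
noncomputable def pencilForm (c d : ℝ) : V →ₗ[ℝ] ℝ :=
  d • (LinearMap.proj 2 ∘ₗ e.toLinearMap) - c • (LinearMap.proj 3 ∘ₗ e.toLinearMap)

theorem pencilForm_apply (c d : ℝ) (v : V) : pencilForm e c d v = d * e v 2 - c * e v 3 := rfl

theorem finrank_ker_pencilForm {c d : ℝ} (h : c ≠ 0 ∨ d ≠ 0) :
    Module.finrank ℝ (LinearMap.ker (pencilForm e c d)) = 3 := by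
  have hne : pencilForm e c d ≠ 0 := by
    intro h0
    have h2 := pencilForm_apply e c d (e.symm ![0, 0, 1, 0])
    have h3 := pencilForm_apply e c d (e.symm ![0, 0, 0, 1])
    rw [h0, LinearMap.zero_apply, e.apply_symm_apply] at h2 h3
    simp at h2 h3
    rcases h with h | h
    · exact h h3
    · exact h h2.symm
  have := Module.Dual.finrank_ker_add_one_of_ne_zero hne
  rw [Module.finrank_fin_fun] at this
  omega

variable {e} {L : Submodule ℝ V}

theorem isHorizontalPlane_ker_pencilForm (heL : ∀ v : V, v ∈ L ↔ e v 2 = 0 ∧ e v 3 = 0)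
    {c d : ℝ} (h : c ≠ 0 ∨ d ≠ 0) : IsHorizontalPlane L (LinearMap.ker (pencilForm e c d)) := by
  refine ⟨finrank_ker_pencilForm e h, fun v hv => ?_⟩
  obtain ⟨h2, h3⟩ := (heL v).mp hv
  simp [pencilForm_apply, h2, h3]

/-- A horizontal plane with a point in the chart is `{z = t w}` for some height `t`. -/
theorem exists_height (heL : ∀ v : V, v ∈ L ↔ e v 2 = 0 ∧ e v 3 = 0) {N : Submodule ℝ V}
    (hN : IsHorizontalPlane L N) {q : E3} (hq : homog e q 1 ∈ N) :
    ∀ v, v ∈ N ↔ e v 2 = q 2 * e v 3 := by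
  have hle : LinearMap.ker (pencilForm e (q 2) 1) ≤ N := by
    intro v hv
    rw [LinearMap.mem_ker, pencilForm_apply] at hv
    have hmem : v - e v 3 • homog e q 1 ∈ L := by
      rw [heL, map_sub, map_smul, e_homog]
      simp
      linarith
    have := N.add_mem (hN.2 hmem) (N.smul_mem (e v 3) hq)
    rwa [sub_add_cancel] at this
  have heq := Submodule.eq_of_le_of_finrank_le hle
    (by rw [finrank_ker_pencilForm e (Or.inr one_ne_zero), hN.1])
  intro v
  rw [← heq, LinearMap.mem_ker, pencilForm_apply, one_mul, sub_eq_zero]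

/-! ### Sections of the body in the chart -/

/-- All horizontal sections of a convex-concave body are non-empty. -/
theorem planeSection_nonempty {B : Set RP3} (hB : IsConvexConcave L B)
    (heL : ∀ v : V, v ∈ L ↔ e v 2 = 0 ∧ e v 3 = 0) {N N' N'' : Submodule ℝ V}
    (hN : IsHorizontalPlane L N) (hN' : IsHorizontalPlane L N') (hN'' : IsHorizontalPlane L N'')
    (h' : N ≠ N') (h'' : N ≠ N'') (h : N' ≠ N'') : (planeSection B N).Nonempty := by
  obtain ⟨p, hp⟩ := hB.nonempty
  induction p using Projectivization.ind with
  | h v hv =>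
    have hvL : v ∉ L := fun hvL =>
      (Set.ext_iff.mp hB.disjoint _).mp ⟨hp, (mk_mem_points hv L).mpr hvL⟩
    -- The point may lie outside the chart, so its horizontal plane is described by the ratio `z :
    -- w`, not by a height.
    have hcd : e v 2 ≠ 0 ∨ e v 3 ≠ 0 := by
      by_contra hc
      push Not at hc
      exact hvL ((heL v).mpr hc)
    have hN₁ := isHorizontalPlane_ker_pencilForm heL hcd
    set N₁ := LinearMap.ker (pencilForm e (e v 2) (e v 3)) with hdef
    have hpN : Projectivization.mk ℝ v hv ∈ planeSection B N₁ := by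
      refine ⟨hp, (mk_mem_points hv _).mpr ?_⟩
      rw [hdef, LinearMap.mem_ker, pencilForm_apply]
      ring
    have key : ∀ N₂, IsHorizontalPlane L N₂ → N₁ ≠ N → N₁ ≠ N₂ → N ≠ N₂ →
        (planeSection B N).Nonempty := by
      intro N₂ hN₂ h1 h2 h3
      obtain ⟨M, -, -, ⟨q, -, hq⟩, -⟩ := hB.concave N₁ N N₂ hN₁ hN hN₂ h1 h2 h3 _ hpN
      exact ⟨q, hq⟩
    -- Concavity needs three distinct planes; `N''` is the spare when `N₁ = N'`.
    by_cases h1 : N₁ = N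
    · exact h1 ▸ ⟨_, hpN⟩
    by_cases h2 : N₁ = N'
    · exact key N'' hN'' h1 (h2 ▸ h) h''
    · exact key N' hN' h1 h2 h'

/-- The sections of a convex-concave body are convex in the chart. -/
theorem convex_affinePart_planeSection {B : Set RP3} (hB : IsConvexConcave L B)
    (heL : ∀ v : V, v ∈ L ↔ e v 2 = 0 ∧ e v 3 = 0) {N : Submodule ℝ V}
    (hN : IsHorizontalPlane L N) {t : ℝ} (ht : ∀ v, v ∈ N ↔ e v 2 = t * e v 3) :
    Convex ℝ (affinePart e (planeSection B N)) := by
  have hker : N ⊓ LinearMap.ker (LinearMap.proj 3 ∘ₗ e.toLinearMap : V →ₗ[ℝ] ℝ) = L := by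
    ext v
    rw [Submodule.mem_inf, LinearMap.mem_ker, heL, ht]
    change _ ∧ e v 3 = 0 ↔ _
    constructor
    · rintro ⟨h1, h2⟩
      exact ⟨by rw [h1, h2, mul_zero], h2⟩
    · rintro ⟨h1, h2⟩
      exact ⟨by rw [h1, h2, mul_zero], h2⟩
  have hc := hB.convex N hN _ hker
  intro p hp q hq a b ha hb hab
  have hmem : ∀ r ∈ affinePart e (planeSection B N), homog e r 1 ∈ {v : V | v ∈ N ∧
      (LinearMap.proj 3 ∘ₗ e.toLinearMap : V →ₗ[ℝ] ℝ) v = 1 ∧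
      ∃ hv : v ≠ 0, Projectivization.mk ℝ v hv ∈ planeSection B N} := fun r hr =>
    ⟨(ofAffine_mem_points e r N).mp hr.2, by
      change e (homog e r 1) 3 = 1
      simp [e_homog], homog_ne_zero e r one_ne_zero, hr⟩
  obtain ⟨-, -, hv, h⟩ := hc (hmem p hp) (hmem q hq) ha hb hab
  have heq : a • homog e p 1 + b • homog e q 1 = homog e (a • p + b • q) 1 := by
    apply e.injective
    rw [map_add, map_smul, map_smul, e_homog, e_homog, e_homog]
    ext i
    fin_cases i <;> simp [hab]
  change ofAffine e (a • p + b • q) ∈ planeSection B N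
  simpa only [heq, ← ofAffine_eq] using h

/-- Sections of a convex-concave body which lie in the chart are compact there. -/
theorem isCompact_affinePart_planeSection {B : Set RP3} (hB : IsConvexConcave L B)
    (heL : ∀ v : V, v ∈ L ↔ e v 2 = 0 ∧ e v 3 = 0) {N : Submodule ℝ V}
    {t : ℝ} (ht : ∀ v, v ∈ N ↔ e v 2 = t * e v 3) :
    IsCompact (affinePart e (planeSection B N)) := by
  obtain ⟨T, hT, hTB⟩ := isClosed_induced_iff.mp hB.closed
  have hTB' : ∀ v (hv : v ≠ 0), v ∈ T ↔ Projectivization.mk ℝ v hv ∈ B := fun v hv =>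
    Set.ext_iff.mp hTB ⟨v, hv⟩
  have hC : IsCompact (Metric.sphere (0 : V) 1 ∩ (T ∩ N)) :=
    (isCompact_sphere 0 1).inter_right (hT.inter N.closed_of_finiteDimensional)
  have hne : ∀ v ∈ Metric.sphere (0 : V) 1, v ≠ 0 := by
    rintro v hv rfl
    simp at hv
  have h3 : ∀ v ∈ Metric.sphere (0 : V) 1 ∩ (T ∩ N), e v 3 ≠ 0 := by
    -- On `N`, `w = 0` forces `z = 0`, hence a point of `L`, which `B` avoids. So the chart map is
    -- continuous on this compact set of unit representatives.
    rintro v ⟨hv, hvT, hvN⟩ h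
    have hvL : v ∈ L := (heL v).mpr ⟨by rw [(ht v).mp hvN, h, mul_zero], h⟩
    exact (Set.ext_iff.mp hB.disjoint _).mp
      ⟨(hTB' v (hne v hv)).mp hvT, (mk_mem_points (hne v hv) L).mpr hvL⟩
  have hcont : ∀ i, Continuous fun v => e v i := fun i =>
    (continuous_apply i).comp e.toLinearMap.continuous_of_finiteDimensional
  have hchart : ContinuousOn (chart e) (Metric.sphere (0 : V) 1 ∩ (T ∩ N)) := by
    refine (PiLp.continuous_toLp 2 _).comp_continuousOn (continuousOn_pi.mpr fun i => ?_)
    fin_cases i <;>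
      exact (hcont _).continuousOn.div (hcont 3).continuousOn h3
  convert hC.image_of_continuousOn hchart using 1
  ext q
  constructor
  · rintro ⟨hqB, hqN⟩
    have h0 := homog_ne_zero e q one_ne_zero
    have hn : ‖homog e q 1‖⁻¹ ≠ 0 := inv_ne_zero (norm_ne_zero_iff.mpr h0)
    refine ⟨‖homog e q 1‖⁻¹ • homog e q 1, ⟨?_, ?_, ?_⟩, chart_smul_homog e q hn⟩
    · rw [mem_sphere_zero_iff_norm, norm_smul, norm_inv, norm_norm,
        inv_mul_cancel₀ (norm_ne_zero_iff.mpr h0)]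
    · rw [hTB' _ (smul_ne_zero hn h0)]
      convert hqB using 1
      rw [ofAffine_eq, Projectivization.mk_eq_mk_iff']
      exact ⟨_, rfl⟩
    · exact N.smul_mem _ ((ofAffine_mem_points e q N).mp hqN)
  · rintro ⟨v, hv, rfl⟩
    change ofAffine e (chart e v) ∈ planeSection B N
    rw [← mk_eq_ofAffine_chart e (hne v hv.1) (h3 v hv)]
    exact ⟨(hTB' v _).mp hv.2.1, (mk_mem_points _ _).mpr hv.2.2⟩

/-! ### Projective lines as parametrized lines -/

/-- The parametrized lines whose point with parameter `t` has height `t`. -/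
def heightLines : Set (E3 × E3) := {x | x.1 2 = 0 ∧ x.2 2 = 1}

theorem convex_heightLines : Convex ℝ heightLines := by
  rintro x ⟨hx1, hx2⟩ y ⟨hy1, hy2⟩ a b - - hab
  constructor <;> simp [hx1, hx2, hy1, hy2, hab]

theorem ev_height {x : E3 × E3} (hx : x ∈ heightLines) (t : ℝ) : ev t x 2 = t := by
  simp [ev_apply, hx.1, hx.2]

theorem mem_heightLines {x : E3 × E3} {s t : ℝ} (hst : s ≠ t) (hs : ev s x 2 = s)
    (ht : ev t x 2 = t) : x ∈ heightLines := by
  simp only [ev_apply, PiLp.add_apply, PiLp.smul_apply, smul_eq_mul] at hs ht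
  have h : (t - s) * (x.2 2 - 1) = 0 := by linarith
  have h1 : x.2 2 = 1 := by
    rcases mul_eq_zero.mp h with h | h
    · exact absurd (sub_eq_zero.mp h).symm hst
    · linarith
  exact ⟨by rw [h1] at hs; linarith, h1⟩

variable (e) in
/-- The projective line with affine parametrization `t ↦ x.1 + t • x.2`. -/
noncomputable def lineSub (x : E3 × E3) : Submodule ℝ V :=
  Submodule.span ℝ {homog e x.1 1, homog e x.2 0}

variable (e) in
theorem homog_ev (x : E3 × E3) (t : ℝ) :
    homog e (ev t x) 1 = homog e x.1 1 + t • homog e x.2 0 := by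
  rw [← homog_add_smul, mul_zero, add_zero, ev_apply]

variable (e) in
theorem homog_ev_mem_lineSub (x : E3 × E3) (t : ℝ) : homog e (ev t x) 1 ∈ lineSub e x := by
  rw [homog_ev]
  exact Submodule.add_mem _ (Submodule.subset_span (by simp))
    (Submodule.smul_mem _ _ (Submodule.subset_span (by simp)))

/-- The two spanning vectors have `(z, w)` equal to `(0, 1)` and `(1, 0)`, so these coordinates are
the coefficients. -/
theorem eq_of_mem_lineSub {x : E3 × E3} (hx : x ∈ heightLines) {v : V} (hv : v ∈ lineSub e x) :
    v = e v 3 • homog e x.1 1 + e v 2 • homog e x.2 0 := by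
  obtain ⟨a, b, rfl⟩ := Submodule.mem_span_pair.mp hv
  simp [e_homog, hx.1, hx.2]

theorem isLine_lineSub {x : E3 × E3} (hx : x ∈ heightLines) : IsLine (lineSub e x) := by
  have hli : LinearIndependent ℝ ![homog e x.1 1, homog e x.2 0] := by
    rw [LinearIndependent.pair_iff]
    intro a b h
    have h2 := congrFun (congrArg e h) 2
    have h3 := congrFun (congrArg e h) 3
    simp [e_homog, hx.1, hx.2] at h2 h3
    exact ⟨h3, h2⟩
  have := finrank_span_eq_card hli
  rw [Matrix.range_cons_cons_empty] at this
  rwa [Fintype.card_fin] at this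

theorem isNonHorizontalLine_lineSub (heL : ∀ v : V, v ∈ L ↔ e v 2 = 0 ∧ e v 3 = 0)
    {x : E3 × E3} (hx : x ∈ heightLines) : IsNonHorizontalLine L (lineSub e x) := by
  refine ⟨isLine_lineSub hx, Set.eq_empty_iff_forall_notMem.mpr fun p => ?_⟩
  induction p using Projectivization.ind with
  | h v hv =>
    rintro ⟨h1, h2⟩
    rw [mk_mem_points] at h1 h2
    obtain ⟨h2, h3⟩ := (heL v).mp h2
    exact hv (by rw [eq_of_mem_lineSub hx h1, h2, h3]; simp)

theorem eq_lineSub {x : E3 × E3} (hx : x ∈ heightLines) {M : Submodule ℝ V} (hM : IsLine M)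
    {s t : ℝ} (hst : s ≠ t) (hs : homog e (ev s x) 1 ∈ M) (ht : homog e (ev t x) 1 ∈ M) :
    M = lineSub e x := by
  rw [homog_ev] at hs ht
  have h2 : homog e x.2 0 ∈ M := by
    have := M.smul_mem (t - s)⁻¹ (M.sub_mem ht hs)
    rwa [add_sub_add_left_eq_sub, ← sub_smul, smul_smul,
      inv_mul_cancel₀ (sub_ne_zero.mpr hst.symm), one_smul] at this
  have h1 : homog e x.1 1 ∈ M := by
    simpa using M.sub_mem hs (M.smul_mem s h2)
  refine (Submodule.eq_of_le_of_finrank_le (Submodule.span_le.mpr ?_) ?_).symm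
  · rintro v (rfl | rfl)
    exacts [h1, h2]
  · exact (hM.trans (isLine_lineSub hx).symm).le

/-- A line through two points of the chart at different heights. -/
theorem exists_lineSub_of_mem {M : Submodule ℝ V} (hM : IsLine M) {p q : E3} (hpq : p 2 ≠ q 2)
    (hp : homog e p 1 ∈ M) (hq : homog e q 1 ∈ M) :
    ∃ x ∈ heightLines, M = lineSub e x := by
  have h1 := ev_lineThrough_left (p 2) (q 2) (p, q)
  have h2 := ev_lineThrough_right hpq (p, q)
  have hx : lineThrough (p 2) (q 2) (p, q) ∈ heightLines :=
    mem_heightLines hpq (by rw [h1]) (by rw [h2])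
  exact ⟨_, hx, eq_lineSub hx hM hpq (by rwa [h1]) (by rwa [h2])⟩

theorem exists_lineSub_of_isNonHorizontalLine (heL : ∀ v : V, v ∈ L ↔ e v 2 = 0 ∧ e v 3 = 0)
    {M : Submodule ℝ V} (hM : IsNonHorizontalLine L M) :
    ∃ x ∈ heightLines, M = lineSub e x := by
  let π : M →ₗ[ℝ] ℝ × ℝ :=
    ((LinearMap.proj 2 ∘ₗ e.toLinearMap).prod (LinearMap.proj 3 ∘ₗ e.toLinearMap)) ∘ₗ M.subtype
  have hπ : ∀ v : M, π v = (e v 2, e v 3) := fun v => rfl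
  -- The kernel of `(z, w)` on `M` is `M ⊓ L`, which is trivial; by dimension, `M` then has a point
  -- at every height.
  have hinj : Function.Injective π := by
    rw [← LinearMap.ker_eq_bot, LinearMap.ker_eq_bot']
    intro v hv
    rw [hπ, Prod.mk_eq_zero, ← heL] at hv
    by_contra h0
    have h0' : (v : V) ≠ 0 := fun h => h0 (Subtype.ext h)
    exact (Set.ext_iff.mp hM.2 _).mp
      ⟨(mk_mem_points h0' M).mpr v.2, (mk_mem_points h0' L).mpr hv⟩
  have hsurj : Function.Surjective π :=
    (LinearMap.injective_iff_surjective_of_finrank_eq_finrank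
      (by rw [Module.finrank_prod, Module.finrank_self]; exact hM.1)).mp hinj
  have hpt : ∀ t : ℝ, ∃ q : E3, q 2 = t ∧ homog e q 1 ∈ M := by
    intro t
    obtain ⟨v, hv⟩ := hsurj (t, 1)
    rw [hπ, Prod.mk.injEq] at hv
    refine ⟨chart e v, by simp [chart, hv.1, hv.2], ?_⟩
    have := eq_smul_homog_chart e (v := v) (by rw [hv.2]; exact one_ne_zero)
    rw [hv.2, one_smul] at this
    exact this ▸ v.2
  obtain ⟨p, hp, hpM⟩ := hpt 0
  obtain ⟨q, hq, hqM⟩ := hpt 1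
  exact exists_lineSub_of_mem hM.1 (by rw [hp, hq]; exact zero_ne_one) hpM hqM

theorem eq_ev_of_mem_lineSub {x : E3 × E3} (hx : x ∈ heightLines) {q : E3}
    (hq : homog e q 1 ∈ lineSub e x) : q = ev (q 2) x := by
  have h := eq_of_mem_lineSub hx hq
  have h3 : e (homog e q 1) 3 = 1 := by simp [e_homog]
  have h2 : e (homog e q 1) 2 = q 2 := by simp [e_homog]
  rw [h3, h2, one_smul, ← homog_ev] at h
  have := congrArg (chart e) h
  rw [← one_smul ℝ (homog e q 1), ← one_smul ℝ (homog e (ev _ x) 1),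
    chart_smul_homog e _ one_ne_zero, chart_smul_homog e _ one_ne_zero] at this
  exact this

theorem affinePart_lineSub_inter {x : E3 × E3} (hx : x ∈ heightLines) {N : Submodule ℝ V} {t : ℝ}
    (ht : ∀ v, v ∈ N ↔ e v 2 = t * e v 3) :
    affinePart e (points (lineSub e x) ∩ points N) = {ev t x} := by
  ext q
  change ofAffine e q ∈ points (lineSub e x) ∧ ofAffine e q ∈ points N ↔ q = ev t x
  rw [ofAffine_mem_points, ofAffine_mem_points]
  have hN : homog e q 1 ∈ N ↔ q 2 = t := by simp [ht, e_homog]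
  rw [hN]
  constructor
  · rintro ⟨h, rfl⟩
    exact eq_ev_of_mem_lineSub hx h
  · rintro rfl
    exact ⟨homog_ev_mem_lineSub e x t, ev_height hx t⟩

theorem setDist_singleton (a : E3) (K : Set E3) : setDist {a} K = Metric.infDist a K := by
  rw [setDist, Set.image2_singleton_left, Metric.infDist_eq_iInf, sInf_image']

end Projective
end ChebyshevLine

/-! ### The main theorem -/

open ChebyshevLine in
theorem mainTheorem6
    (L : Submodule ℝ V) (B : Set RP3) (hB : IsConvexConcave L B)
    (P : Fin 5 → Submodule ℝ V) (hP : ∀ i, IsHorizontalPlane L (P i))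
    (hinj : Function.Injective P)
    (e : V ≃ₗ[ℝ] V) (heL : ∀ v : V, v ∈ L ↔ e v 2 = 0 ∧ e v 3 = 0)
    (heS : ∀ i, planeSection B (P i) ⊆ Set.range (ofAffine e))
    (M : Submodule ℝ V) (hM : IsChebyshevLine L e B P M) :
    (∃ r : ℝ, ∀ i, distToSection e B M (P i) = r ∧
      ∃ a s : E3, affinePart e (points M ∩ points (P i)) = {a} ∧
        s ∈ affinePart e (planeSection B (P i)) ∧
        (∀ q ∈ affinePart e (planeSection B (P i)), dist a s ≤ dist a q) ∧
        dist a s = r) ∧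
    ((¬ ∃ M' : Submodule ℝ V, IsLine M' ∧
        ∀ i, (points M' ∩ planeSection B (P i)).Nonempty) →
      ∀ i, points M ∩ planeSection B (P i) = ∅) := by
  have hne : ∀ i, (affinePart e (planeSection B (P i))).Nonempty := by
    intro i
    have key : ∀ i : Fin 5, i ≠ i + 1 ∧ i ≠ i + 2 ∧ i + 1 ≠ i + 2 := by decide
    obtain ⟨h1, h2, h3⟩ := key i
    obtain ⟨p, hp⟩ := planeSection_nonempty hB heL (hP i) (hP (i + 1)) (hP (i + 2))
      (hinj.ne h1) (hinj.ne h2) (hinj.ne h3)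
    obtain ⟨q, rfl⟩ := heS i hp
    exact ⟨q, hp⟩
  have hheight : ∀ i, ∃ t : ℝ, ∀ v, v ∈ P i ↔ e v 2 = t * e v 3 := fun i =>
    let ⟨q, hq⟩ := hne i
    ⟨q 2, exists_height heL (hP i) ((ofAffine_mem_points e q _).mp hq.2)⟩
  choose t ht using hheight
  have htinj : Function.Injective t := fun i j hij =>
    hinj (Submodule.ext fun v => by rw [ht, ht, hij])
  have hcomp := fun i => isCompact_affinePart_planeSection hB heL (ht i)
  have hconv := fun i => convex_affinePart_planeSection hB heL (hP i) (ht i)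
  have hlevel : ∀ i, ∀ q ∈ affinePart e (planeSection B (P i)), q 2 = t i := by
    intro i q hq
    simpa [ht, e_homog] using (ofAffine_mem_points e q _).mp hq.2
  have hconc : ∀ i j k, i ≠ j → i ≠ k → j ≠ k → ∀ q ∈ affinePart e (planeSection B (P i)),
      ∃ x : E3 × E3, ev (t i) x = q ∧ ev (t j) x ∈ affinePart e (planeSection B (P j)) ∧
        ev (t k) x ∈ affinePart e (planeSection B (P k)) := by
    intro i j k hij hik hjk q hq
    obtain ⟨M', hM', hqM, ⟨p₁, hp₁M, hp₁⟩, ⟨p₂, hp₂M, hp₂⟩⟩ := hB.concave _ _ _ (hP i) (hP j)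
      (hP k) (hinj.ne hij) (hinj.ne hik) (hinj.ne hjk) _ hq
    obtain ⟨q₁, rfl⟩ := heS j hp₁
    obtain ⟨q₂, rfl⟩ := heS k hp₂
    rw [ofAffine_mem_points] at hqM hp₁M hp₂M
    have hl := hlevel i q hq
    have hl₁ := hlevel j q₁ hp₁
    have hl₂ := hlevel k q₂ hp₂
    obtain ⟨x, hx, rfl⟩ := exists_lineSub_of_mem hM'
      (by rw [hl, hl₁]; exact htinj.ne hij) hqM hp₁M
    have h := eq_ev_of_mem_lineSub hx hqM
    have h₁ := eq_ev_of_mem_lineSub hx hp₁M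
    have h₂ := eq_ev_of_mem_lineSub hx hp₂M
    rw [hl] at h
    rw [hl₁] at h₁
    rw [hl₂] at h₂
    exact ⟨x, h.symm, h₁ ▸ hp₁, h₂ ▸ hp₂⟩
  have hmeet : ∀ i, ∃ x ∈ heightLines, ∀ j, j ≠ i →
      ev (t j) x ∈ affinePart e (planeSection B (P j)) := by
    intro i
    obtain ⟨x, hx⟩ := exists_line_meeting_all_but_one htinj hcomp hconv hne hconc i
    have key : ∀ i : Fin 5, i + 1 ≠ i ∧ i + 2 ≠ i ∧ i + 1 ≠ i + 2 := by decide
    obtain ⟨h1, h2, h3⟩ := key i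
    exact ⟨x, mem_heightLines (htinj.ne h3) (hlevel _ _ (hx _ h1)) (hlevel _ _ (hx _ h2)), hx⟩
  have hdist : ∀ x ∈ heightLines, ∀ i, distToSection e B (lineSub e x) (P i) =
      Metric.infDist (ev (t i) x) (affinePart e (planeSection B (P i))) := fun x hx i => by
    rw [distToSection, affinePart_lineSub_inter hx (ht i), setDist_singleton]
  obtain ⟨hMnon, hMmin⟩ := hM
  obtain ⟨m, hm, rfl⟩ := exists_lineSub_of_isNonHorizontalLine heL hMnon
  have heq := infDist_eq_iSup_of_minimizer hcomp hconv convex_heightLines hmeet hm (fun x hx => by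
    simpa only [hdist _ hm, hdist _ hx] using hMmin _ (isNonHorizontalLine_lineSub heL hx))
  set r := ⨆ j, Metric.infDist (ev (t j) m) (affinePart e (planeSection B (P j))) with hr
  -- Sections are closed, so distance `0` means incidence.
  have hmemK : ∀ i, r = 0 → ev (t i) m ∈ affinePart e (planeSection B (P i)) := fun i h0 =>
    ((hcomp i).isClosed.mem_iff_infDist_zero (hne i)).mpr ((heq i).trans h0)
  refine ⟨⟨r, fun i => ⟨(hdist m hm i).trans (heq i), ?_⟩⟩, fun hno i => ?_⟩
  · obtain ⟨s, hs, hsd⟩ := (hcomp i).exists_infDist_eq_dist (hne i) (ev (t i) m)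
    exact ⟨ev (t i) m, s, affinePart_lineSub_inter hm (ht i), hs,
      fun q hq => hsd ▸ Metric.infDist_le_dist_of_mem hq, hsd ▸ heq i⟩
  · refine Set.eq_empty_iff_forall_notMem.mpr fun p ⟨hpM, hp⟩ => hno ?_
    obtain ⟨q, rfl⟩ := heS i hp
    have hqm : q = ev (t i) m := by
      have : q ∈ affinePart e (points (lineSub e m) ∩ points (P i)) := ⟨hpM, hp.2⟩
      rwa [affinePart_lineSub_inter hm (ht i)] at this
    have h0 : r = 0 := by
      rw [← heq i, ← hqm]
      exact Metric.infDist_zero_of_mem hp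
    exact ⟨lineSub e m, hMnon.1, fun j => ⟨ofAffine e (ev (t j) m),
      (ofAffine_mem_points e _ _).mpr (homog_ev_mem_lineSub e m (t j)), hmemK j h0⟩⟩
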